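/- Let $G=(V,E)$ be a finite directed acyclic graph, with positive integer delays $m_{i,j}$ on its edges $j\to i$, and let $\mathcal N_i$ be the set of in-neighbours of the node $i$ (the $j$ with an edge $j\to i$). Let $\mathcal N^e\subseteq V$ be the set of excited nodes. A family $\Phi=(\Phi_i)_{i\in V}$ of node functions in the class $\mathcal F_{Pol}$ consists of real polynomial functions $\Phi_i:\mathbb R^{\mathcal N_i}\to\mathbb R$; it is consistent with $G$ if $\partial\Phi_i/\partial y_j\not\equiv 0$ for every edge $j\to i$. The outputs of the network are given by $$y_i^k=u_i^{k-1}+\Phi_i\big((y_j^{k-m_{i,j}})_{j\in\mathcal N_i}\big)\qquad(i\in V,\ k\in\mathbb Z),$$ where $u_i$ is an arbitrary signal if $i\in\mathcal N^e$ and $u_i=0$ otherwise. All nodes are measured: for every $i\in V$ the function $F_i$ of the excitation signals defined by $y_i^k=u_i^{k-1}+F_i$ is known. Assume that the delays are path-independent: for every excited node $a$ and every node $b$, all directed paths from $a$ to $b$ have the same total delay. Call $\Phi$ identifiable if, for every family $\tilde\Phi$ of polynomial node functions that is consistent with $G$ and generates the same measured functions ($\tilde F_i=F_i$ for all $i\in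 V$), one has $\tilde\Phi=\Phi$. Call the network generically identifiable in $\mathcal F_{Pol}$ if there is an integer $K\ge 1$ such that, for every choice of the (finitely many nonzero) coefficients of the $\Phi_i$ of total degree greater than $K$, the family $\Phi$ is identifiable for all values of the vector of the coefficients of the $\Phi_i$ of total degree at most $K$ except those in a set of Lebesgue measure zero. Then the network is generically identifiable in $\mathcal F_{Pol}$ if and only if, for each node $i\in V$, there are $|\mathcal N_i|$ mutually vertex-disjoint directed paths (possibly of length zero) that start at excited nodes and end at the distinct in-neighbours of $i$. The same equivalence holds if, in the definition of generic identifiability, only the zero choice of the coefficients of $\Phi$ of total degree greater than $K$ is considered (the alternative $\tilde\Phi$ still having any degree). -/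

import Mathlib

open MeasureTheory

/-- The known data of a network on a directed acyclic graph: the graph, the set of excited nodes,
and the delays.  `graph.Adj j i` means that there is an edge from `j` to `i`, that is, `j` is an
in-neighbour of `i`; `delay i j` is the (positive) delay with which the output of the in-neighbour
`j` enters the dynamics of `i`.  All the nodes are measured. -/
structure DAGNetwork (V : Type*) where
  graph : Digraph V
  acyclic : ∀ v, ¬ Relation.TransGen graph.Adj v v
  excited : Set V
  delay : V → V → ℕ
  delay_pos : ∀ j i, graph.Adj j i → 0 < delay i j

namespace DAGNetwork

variable {V : Type*} (N : DAGNetwork V)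

/-- The set of in-neighbours of the node `i`. -/
abbrev InNbr (i : V) : Type _ := {j : V // N.graph.Adj j i}

/-! ### Node functions of the polynomial class -/

/-- A family `Φ` of polynomial node functions: `Φ i` is a real polynomial whose variables are
the outputs of the in-neighbours of `i`. -/
abbrev NodeFunctions : Type _ := (i : V) → MvPolynomial (N.InNbr i) ℝ

/-- The node functions are consistent with the graph: for every edge from `j` to `i`, the partial
derivative of `Φ i` with respect to `y j` is not identically zero. -/
def Consistent (Φ : N.NodeFunctions) : Prop :=
  ∀ (i : V) (j : N.InNbr i), MvPolynomial.pderiv j (Φ i) ≠ 0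

/-! ### Dynamics and measured functions -/

/-- Excitation signals, one for each excited node, with discrete time in `ℤ`. -/
abbrev Excitation : Type _ := N.excited → ℤ → ℝ

open Classical in
/-- The external signals `u i` of all nodes: zero at the nodes that are not excited. -/
noncomputable def signal (w : N.Excitation) (i : V) (k : ℤ) : ℝ :=
  if h : i ∈ N.excited then w ⟨i, h⟩ k else 0

theorem wellFounded_adj [Finite V] : WellFounded N.graph.Adj := by
  have : Std.Irrefl (Relation.TransGen N.graph.Adj) := ⟨N.acyclic⟩
  have h := Finite.wellFounded_of_trans_of_irrefl (Relation.TransGen N.graph.Adj)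
  exact Subrelation.wf (fun {_ _} hab => Relation.TransGen.single hab) h

/-- The output `y i k` of the node `i` at time `k`, that is, the solution of
`y i k = u i (k - 1) + Φ i (y j (k - delay i j) : j an in-neighbour of i)`. -/
noncomputable def output [Finite V] (Φ : N.NodeFunctions) (w : N.Excitation) : V → ℤ → ℝ :=
  N.wellFounded_adj.fix fun i y k =>
    N.signal w i (k - 1) +
      MvPolynomial.eval (fun j : N.InNbr i => y j.1 j.2 (k - (N.delay i j.1 : ℤ))) (Φ i)

theorem output_eq [Finite V] (Φ : N.NodeFunctions) (w : N.Excitation) (i : V) (k : ℤ) :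
    N.output Φ w i k = N.signal w i (k - 1) +
      MvPolynomial.eval (fun j : N.InNbr i => N.output Φ w j.1 (k - (N.delay i j.1 : ℤ))) (Φ i) := by
  unfold output
  rw [WellFounded.fix_eq]

/-- The family of measured functions generated by `Φ`: `F i` is defined by
`y i k = u i (k - 1) + F i`, as a function of the excitation signals (and of the time `k`). -/
noncomputable def measuredFunctions [Finite V] (Φ : N.NodeFunctions) :
    V → N.Excitation → ℤ → ℝ :=
  fun i w k => N.output Φ w i k - N.signal w i (k - 1)

/-- `Φ` is determined by the measured functions that it generates, among all families of polynomial
node functions that are consistent with the graph. -/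
def Identifiable [Finite V] (Φ : N.NodeFunctions) : Prop :=
  ∀ Ψ : N.NodeFunctions, N.Consistent Ψ →
    N.measuredFunctions Φ = N.measuredFunctions Ψ → Φ = Ψ

/-! ### Genericity -/

/-- The exponents of the monomials of total degree at most `K` in the arguments of `Φ i`. -/
abbrev LowExponent (K : ℕ) (i : V) : Type _ := {d : N.InNbr i →₀ ℕ // d.degree ≤ K}

noncomputable instance [Finite V] (K : ℕ) (i : V) : Fintype (N.LowExponent K i) :=
  haveI : Finite (N.LowExponent K i) := (Finsupp.finite_of_degree_le K).to_subtype
  Fintype.ofFinite _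

/-- The vector of all the coefficients of degree at most `K` of all the node functions. -/
abbrev Param (K : ℕ) : Type _ := (Σ i : V, N.LowExponent K i) → ℝ

/-- `β` contains only terms of degree greater than `K`. -/
def IsTail (K : ℕ) (β : N.NodeFunctions) : Prop :=
  ∀ (i : V) (d : N.InNbr i →₀ ℕ), d.degree ≤ K → MvPolynomial.coeff d (β i) = 0

/-- The node functions with coefficients `α` in degree at most `K`, and terms of higher degree
given by `β`. -/
noncomputable def parametrize [Finite V] (K : ℕ) (α : N.Param K) (β : N.NodeFunctions) :
    N.NodeFunctions :=
  fun i => (∑ d : N.LowExponent K i, MvPolynomial.monomial d.1 (α ⟨i, d⟩)) + β i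

/-- A property of the node functions holds `K`-generically: for every choice of the terms of degree
greater than `K`, it holds for all coefficients of degree at most `K` except those in a set of
Lebesgue measure zero. -/
def KGenerically [Fintype V] (K : ℕ) (P : N.NodeFunctions → Prop) : Prop :=
  ∀ β : N.NodeFunctions, N.IsTail K β →
    ∀ᵐ α ∂(volume : Measure (N.Param K)), P (N.parametrize K α β)

/-- A property holds generically if it holds `K`-generically for some positive integer `K`. -/
def Generically [Fintype V] (P : N.NodeFunctions → Prop) : Prop :=
  ∃ K : ℕ, 0 < K ∧ N.KGenerically K P

/-- Generic identifiability in the class of polynomial node functions. -/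
def GenericallyIdentifiable [Fintype V] : Prop :=
  N.Generically N.Identifiable

/-- Generic identifiability where the generic node functions are polynomials of degree at most `K`
for some `K` (all the terms of degree greater than `K` are zero). The alternative node functions,
in the definition of `Identifiable`, are polynomials of any degree. -/
def TruncatedGenericallyIdentifiable [Fintype V] : Prop :=
  ∃ K : ℕ, 0 < K ∧
    ∀ᵐ α ∂(volume : Measure (N.Param K)), N.Identifiable (N.parametrize K α 0)

/-! ### Paths -/

/-- `p` is the list of the vertices of a directed path from `a` to `b` (the one-vertex path is
allowed when `a = b`; vertices do not repeat because the graph is acyclic). -/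
def IsPath (p : List V) (a b : V) : Prop :=
  p.IsChain N.graph.Adj ∧ p.head? = some a ∧ p.getLast? = some b

/-- The total delay along a list of vertices. -/
def pathDelay : List V → ℕ
  | [] => 0
  | [_] => 0
  | a :: b :: l => N.delay b a + pathDelay (b :: l)

/-- Path-independent delays: all the paths from a given excited node to a given node have the same
total delay. -/
def PathIndependentDelay : Prop :=
  ∀ a ∈ N.excited, ∀ (b : V) (p q : List V),
    N.IsPath p a b → N.IsPath q a b → N.pathDelay p = N.pathDelay q

/-- For each node `i`, there are mutually vertex-disjoint paths from excited nodes to the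
in-neighbours of `i`, one path for each in-neighbour. -/
def HasVertexDisjointPaths : Prop :=
  ∀ i : V, ∃ p : N.InNbr i → List V,
    (∀ j : N.InNbr i, ∃ a ∈ N.excited, N.IsPath (p j) a j.1) ∧
      ∀ j j' : N.InNbr i, j ≠ j' → List.Disjoint (p j) (p j')

end DAGNetwork

/-! Path-independent delays remove time from the problem: each output is the value, at suitably
shifted excitations, of a polynomial `staticOutput` of the delay-free network, so two families
generate the same measured functions iff their static outputs agree (`measuredFunctions_eq_iff`).
Since `Φ i` is seen only through its composition with the static outputs of the in-neighbours, it is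
determined modulo the algebraic relations between them. For a consistent family, identifiability is
therefore algebraic independence of the inputs of every node (`IndependentInputs`).

Independence forces disjoint paths by an exchange argument: the deepest output is traded for that of
an in-neighbour until excited nodes are reached (`exists_isLinkage`). Conversely, a nonzero Jacobian
minor at zero excitation gives independence. This minor is a polynomial in the low-degree
coefficients, and it is nonzero for the linear coefficients that route excitations along disjoint
paths (`det_jacobian_routing_ne_zero`), whatever the tail; so it vanishes only on a null set,
already with `K = 1`. Both equivalences follow from the cycle generic, truncated generic, disjoint
paths, generic. -/

namespace MvPolynomial

/-! ### Partial derivatives and algebraic independence -/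

theorem pderiv_aeval {σ τ R : Type*} [CommSemiring R] [Fintype σ] (f : σ → MvPolynomial τ R)
    (a : τ) (p : MvPolynomial σ R) :
    pderiv a (aeval f p) = ∑ j, aeval f (pderiv j p) * pderiv a (f j) := by
  classical
  induction p using MvPolynomial.induction_on with
  | C r => simp [algebraMap_eq]
  | add p q hp hq => simp only [map_add, hp, hq, add_mul, Finset.sum_add_distrib]
  | mul_X p i hp =>
    simp only [map_mul, aeval_X, pderiv_mul, hp, map_add, pderiv_X, Pi.single_apply,
      add_mul, Finset.sum_add_distrib, Finset.sum_mul]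
    congr 1
    · exact Finset.sum_congr rfl fun j _ => by ring
    · simp

theorem eval_aeval {σ τ R : Type*} [CommSemiring R] (f : σ → MvPolynomial τ R) (v : τ → R)
    (p : MvPolynomial σ R) : eval v (aeval f p) = eval (fun j => eval v (f j)) p := by
  induction p using MvPolynomial.induction_on with
  | C r => simp [algebraMap_eq]
  | add p q hp hq => simp only [map_add, hp, hq]
  | mul_X p i hp => simp only [map_mul, hp, aeval_X, eval_X]

theorem eval_zero_pderiv {σ R : Type*} [CommSemiring R] (p : MvPolynomial σ R) (j : σ) :
    eval 0 (pderiv j p) = coeff (Finsupp.single j 1) p := by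
  rw [eval_zero, constantCoeff_eq, coeff_pderiv]
  simp

theorem totalDegree_pderiv_lt {σ R : Type*} [CommSemiring R] {p : MvPolynomial σ R} {j : σ}
    (h : pderiv j p ≠ 0) : (pderiv j p).totalDegree < p.totalDegree := by
  obtain ⟨d, hd, hdeg⟩ := Finset.exists_mem_eq_sup (pderiv j p).support (support_nonempty.2 h)
    (fun s => s.sum fun _ e => e)
  have hc : coeff (d + Finsupp.single j 1) p ≠ 0 := by
    intro h0
    rw [mem_support_iff, coeff_pderiv, h0, zero_mul] at hd
    exact hd rfl
  have := le_totalDegree (mem_support_iff.2 hc)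
  rw [Finsupp.sum_add_index' (by simp) (by simp)] at this
  rw [totalDegree, hdeg]
  simp at this ⊢
  omega

theorem eq_C_of_pderiv_eq_zero {σ R : Type*} [CommRing R] [IsDomain R] [CharZero R]
    {p : MvPolynomial σ R} (h : ∀ j, pderiv j p = 0) : p = C (coeff 0 p) := by
  classical
  ext d
  rw [coeff_C]
  split_ifs with h0
  · rw [h0]
  · obtain ⟨j, hj⟩ := Finsupp.ne_iff.1 (Ne.symm h0)
    have hle : Finsupp.single j 1 ≤ d := by
      rw [Finsupp.single_le_iff]
      exact Nat.one_le_iff_ne_zero.2 hj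
    have := congrArg (coeff (d - Finsupp.single j 1)) (h j)
    rw [coeff_pderiv, tsub_add_cancel_of_le hle, coeff_zero] at this
    exact (mul_eq_zero.1 this).resolve_right (by norm_cast)

/-- The Jacobian criterion for algebraic independence, at the origin. -/
theorem algebraicIndependent_of_det_ne_zero {ι τ R : Type*} [Fintype ι] [DecidableEq ι]
    [CommRing R] [IsDomain R] [CharZero R] (f : ι → MvPolynomial τ R) (a : ι → τ)
    (h : (Matrix.of fun j l => eval 0 (pderiv (a l) (f j))).det ≠ 0) :
    AlgebraicIndependent R f := by
  rw [algebraicIndependent_iff]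
  intro p
  induction hn : p.totalDegree using Nat.strong_induction_on generalizing p with
  | _ n ih =>
  intro hp
  set M : Matrix ι ι (MvPolynomial τ R) := Matrix.of fun j l => pderiv (a l) (f j)
  have hM : M.det ≠ 0 := by
    intro h0
    apply h
    have := congrArg (eval (0 : τ → R)) h0
    rw [RingHom.map_det, map_zero] at this
    exact this
  -- Differentiating the relation `p(f) = 0` shows that the vector of the `(∂ⱼp)(f)` is killed by an
  -- invertible matrix over the fraction field. So every `∂ⱼp` is again a relation, of smaller
  -- degree unless zero.
  have hker : Matrix.vecMul (fun j => aeval f (pderiv j p)) M = 0 := by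
    ext1 l
    have := pderiv_aeval f (a l) p
    rw [hp, map_zero] at this
    exact this.symm
  have hv := Matrix.eq_zero_of_vecMul_eq_zero hM hker
  have hd : ∀ j, pderiv j p = 0 := by
    intro j
    by_contra hj
    exact hj (ih _ (hn ▸ totalDegree_pderiv_lt hj) _ rfl (congrFun hv j))
  have hC := eq_C_of_pderiv_eq_zero hd
  rw [hC, aeval_C, algebraMap_eq, C_eq_zero] at hp
  rw [hC, hp, C_0]

/-! ### Zero sets of nonzero polynomials are null -/

/-- Fubini: for almost all values of the other variables the leading coefficient in the first
variable is nonzero, and then only finitely many values of the first variable are roots. -/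
theorem ae_eval_ne_zero_fin (n : ℕ) (p : MvPolynomial (Fin n) ℝ) (hp : p ≠ 0) :
    ∀ᵐ x ∂(volume : Measure (Fin n → ℝ)), eval x p ≠ 0 := by
  induction n with
  | zero =>
    refine Filter.Eventually.of_forall fun x h => hp ?_
    refine MvPolynomial.funext fun y => ?_
    rw [Subsingleton.elim y x, h, map_zero]
  | succ n ih =>
    set q := finSuccEquiv ℝ n p
    have hq : q ≠ 0 := by simpa [q] using hp
    have hmp := volume_preserving_piFinSuccAbove (fun _ : Fin (n + 1) => ℝ) 0
    have key : ∀ᵐ z ∂(volume : Measure (ℝ × (Fin n → ℝ))),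
        eval (Fin.cons z.1 z.2 : Fin (n + 1) → ℝ) p ≠ 0 := by
      have hcont : Continuous fun z : ℝ × (Fin n → ℝ) =>
          eval (Fin.cons z.1 z.2 : Fin (n + 1) → ℝ) p :=
        (continuous_eval p).comp <| continuous_pi <| Fin.cases continuous_fst
          fun i => (continuous_apply i).comp continuous_snd
      have hmeas : MeasurableSet {z : ℝ × (Fin n → ℝ) |
          eval (Fin.cons z.1 z.2 : Fin (n + 1) → ℝ) p ≠ 0} :=
        (isOpen_ne.preimage hcont).measurableSet
      rw [Measure.volume_eq_prod, Measure.ae_prod_iff_ae_ae hmeas,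
        Measure.ae_ae_comm (p := fun y s => eval (Fin.cons y s : Fin (n + 1) → ℝ) p ≠ 0) hmeas]
      filter_upwards [ih _ (Polynomial.leadingCoeff_ne_zero.2 hq)] with s hs
      have hqs : q.map (eval s) ≠ 0 := by
        intro h0
        apply hs
        rw [Polynomial.leadingCoeff, ← Polynomial.coeff_map, h0, Polynomial.coeff_zero]
      have hfin : {y : ℝ | (q.map (eval s)).IsRoot y}.Finite :=
        Polynomial.finite_setOfPred_isRoot hqs
      filter_upwards [compl_mem_ae_iff.2 (hfin.measure_zero volume)] with y hy
      rw [eval_eq_eval_mv_eval']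
      exact hy
    filter_upwards [hmp.quasiMeasurePreserving.ae key] with x hx
    convert hx using 3
    exact (Fin.cons_self_tail x).symm

theorem ae_eval_ne_zero {ι : Type*} [Fintype ι] {p : MvPolynomial ι ℝ} (hp : p ≠ 0) :
    ∀ᵐ x ∂(volume : Measure (ι → ℝ)), eval x p ≠ 0 := by
  have e := Fintype.equivFin ι
  have hmp := volume_measurePreserving_piCongrLeft (fun _ => ℝ) e
  have hq : rename e p ≠ 0 := by
    rw [Ne, ← map_zero (rename e), (rename_injective e e.injective).eq_iff]; exact hp
  filter_upwards [hmp.quasiMeasurePreserving.ae (ae_eval_ne_zero_fin _ _ hq)] with x hx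
  rw [eval_rename] at hx
  convert hx using 3
  ext i
  simp [MeasurableEquiv.coe_piCongrLeft]

end MvPolynomial

namespace DAGNetwork

variable {V : Type*} (N : DAGNetwork V)

/-! ### Static outputs -/

open Classical in
/-- The variable of the excitation of a node, zero at the nodes that are not excited. -/
noncomputable def source (i : V) : MvPolynomial N.excited ℝ :=
  if h : i ∈ N.excited then MvPolynomial.X ⟨i, h⟩ else 0

/-- The outputs of the delay-free network as polynomials in the excitations. -/
noncomputable def staticOutput [Finite V] (Φ : N.NodeFunctions) : V → MvPolynomial N.excited ℝ :=
  N.wellFounded_adj.fix fun i Y =>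
    N.source i + MvPolynomial.aeval (fun j : N.InNbr i => Y j.1 j.2) (Φ i)

variable {N}

theorem staticOutput_eq [Finite V] (Φ : N.NodeFunctions) (i : V) :
    N.staticOutput Φ i = N.source i +
      MvPolynomial.aeval (fun j : N.InNbr i => N.staticOutput Φ j.1) (Φ i) := by
  unfold staticOutput
  rw [WellFounded.fix_eq]

theorem eq_staticOutput [Finite V] {Φ : N.NodeFunctions} {Y : V → MvPolynomial N.excited ℝ}
    (h : ∀ i, Y i = N.source i + MvPolynomial.aeval (fun j : N.InNbr i => Y j.1) (Φ i)) :
    Y = N.staticOutput Φ := by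
  funext i
  induction i using N.wellFounded_adj.induction with
  | _ i ih =>
  rw [h, staticOutput_eq]
  congr 2
  exact congrArg _ (funext fun j => ih j.1 j.2)

theorem eval_source (v : N.excited → ℝ) (w : N.Excitation) (i : V) (k : ℤ)
    (h : ∀ a : N.excited, a.1 = i → v a = w a k) :
    MvPolynomial.eval v (N.source i) = N.signal w i k := by
  unfold source signal
  split_ifs with hi
  · rw [MvPolynomial.eval_X, h _ rfl]
  · exact map_zero _

/-! ### Paths and delays -/

theorem isPath_singleton (a : V) : N.IsPath [a] a a :=
  ⟨List.isChain_singleton a, rfl, rfl⟩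

theorem IsPath.concat {p : List V} {a j i : V} (hp : N.IsPath p a j) (hji : N.graph.Adj j i) :
    N.IsPath (p ++ [i]) a i := by
  obtain ⟨h1, h2, h3⟩ := hp
  refine ⟨?_, ?_, by simp⟩
  · rw [List.isChain_append]
    refine ⟨h1, List.isChain_singleton i, ?_⟩
    rintro x hx y hy
    rw [h3] at hx
    simp at hx hy
    subst hx hy
    exact hji
  · rw [List.head?_append, h2]
    rfl

theorem pathDelay_concat {p : List V} {j : V} (hp : p.getLast? = some j) (i : V) :
    N.pathDelay (p ++ [i]) = N.pathDelay p + N.delay i j := by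
  induction p with
  | nil => simp at hp
  | cons a l ih =>
    cases l with
    | nil =>
      simp at hp
      subst hp
      simp [pathDelay]
    | cons b l =>
      have := ih (by simpa using hp)
      simp only [List.cons_append, pathDelay] at this ⊢
      omega

open Classical in
/-- The total delay from `a` to `b`, along an arbitrary path. -/
noncomputable def travelTime (N : DAGNetwork V) (a b : V) : ℕ :=
  if h : ∃ p, N.IsPath p a b then N.pathDelay h.choose else 0

theorem travelTime_eq (hN : N.PathIndependentDelay) {a b : V} (ha : a ∈ N.excited) {p : List V}
    (hp : N.IsPath p a b) : N.travelTime a b = N.pathDelay p := by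
  have h : ∃ p, N.IsPath p a b := ⟨p, hp⟩
  rw [travelTime, dif_pos h]
  exact hN a ha b _ _ h.choose_spec hp

/-- With path-independent delays the outputs of the network are the values of the static outputs
at suitably delayed excitations. -/
theorem output_eq_eval_staticOutput [Finite V] (hN : N.PathIndependentDelay) (Φ : N.NodeFunctions)
    (w : N.Excitation) (i : V) (k : ℤ) (v : N.excited → ℝ)
    (hv : ∀ a : N.excited, (∃ p, N.IsPath p a i) → v a = w a (k - 1 - N.travelTime a i)) :
    N.output Φ w i k = MvPolynomial.eval v (N.staticOutput Φ i) := by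
  induction i using N.wellFounded_adj.induction generalizing k with
  | _ i ih =>
  rw [output_eq, staticOutput_eq, map_add]
  congr 1
  · refine (eval_source v w i _ ?_).symm
    rintro ⟨a, ha⟩ rfl
    rw [hv _ ⟨_, isPath_singleton a⟩, travelTime_eq hN ha (isPath_singleton a)]
    simp [pathDelay]
  · rw [MvPolynomial.eval_aeval]
    refine congrArg (fun y => MvPolynomial.eval y (Φ i)) (funext fun j => ih j.1 j.2 _ ?_)
    -- A path to `j` extends to `i`, so the travel times differ by the delay of the edge. An excited
    -- node reaching `i` but not `j` has the default travel time 0 to `j`, which is why `hv`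
    -- concerns only nodes with a path.
    rintro a ⟨p, hp⟩
    rw [hv a ⟨_, hp.concat j.2⟩, travelTime_eq hN a.2 (hp.concat j.2), travelTime_eq hN a.2 hp,
      pathDelay_concat hp.2.2]
    congr 1
    push_cast
    ring

/-- Constant signals are unaffected by the delays and already recover the static outputs as
polynomial functions on real space. -/
theorem measuredFunctions_eq_iff [Finite V] (hN : N.PathIndependentDelay) (Φ Ψ : N.NodeFunctions) :
    N.measuredFunctions Φ = N.measuredFunctions Ψ ↔ N.staticOutput Φ = N.staticOutput Ψ := by
  constructor
  · intro h
    funext i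
    refine MvPolynomial.funext fun u => ?_
    have := congrFun (congrFun (congrFun h i) fun a _ => u a) 0
    unfold measuredFunctions at this
    rw [sub_left_inj, output_eq_eval_staticOutput hN Φ _ i 0 u fun _ _ => rfl,
      output_eq_eval_staticOutput hN Ψ _ i 0 u fun _ _ => rfl] at this
    exact this
  · intro h
    funext i w k
    unfold measuredFunctions
    rw [output_eq_eval_staticOutput hN Φ w i k _ fun _ _ => rfl,
      output_eq_eval_staticOutput hN Ψ w i k _ fun _ _ => rfl, h]

/-! ### Identifiability and algebraic independence -/

/-- The outputs of the in-neighbours of every node are algebraically independent. -/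
def IndependentInputs [Finite V] (Φ : N.NodeFunctions) : Prop :=
  ∀ i, AlgebraicIndependent ℝ fun j : N.InNbr i => N.staticOutput Φ j.1

theorem IndependentInputs.identifiable [Finite V] (hN : N.PathIndependentDelay)
    {Φ : N.NodeFunctions} (h : IndependentInputs Φ) : N.Identifiable Φ := by
  intro Ψ _ hΨ
  rw [measuredFunctions_eq_iff hN] at hΨ
  funext i
  have h1 := staticOutput_eq Φ i
  rw [hΨ, staticOutput_eq Ψ i, add_right_inj] at h1
  have h2 := h i
  rw [hΨ] at h2
  exact (algebraicIndependent_iff_injective_aeval.1 h2) h1.symm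

/-- Adding a multiple of a relation `Q` between the inputs to `Φ i` changes no output, so a
nontrivial relation would contradict identifiability. -/
theorem Identifiable.independentInputs [Finite V] (hN : N.PathIndependentDelay)
    {Φ : N.NodeFunctions} (hc : N.Consistent Φ) (h : N.Identifiable Φ) :
    IndependentInputs Φ := by
  classical
  intro i
  by_contra hi
  rw [algebraicIndependent_iff] at hi
  push Not at hi
  obtain ⟨Q, hQ, hQ0⟩ := hi
  obtain ⟨c, hc0, hcj⟩ : ∃ c : ℝ, c ≠ 0 ∧
      ∀ j : N.InNbr i, MvPolynomial.pderiv j (Φ i + c • Q) ≠ 0 := by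
    -- Each edge into `i` excludes at most one `c`: two such values would give `∂ⱼQ = 0` and hence
    -- `∂ⱼ(Φ i) = 0`, against consistency.
    have hfin : ({0} ∪ ⋃ j : N.InNbr i,
        {c : ℝ | MvPolynomial.pderiv j (Φ i + c • Q) = 0}).Finite := by
      refine (Set.finite_singleton _).union (Set.finite_iUnion fun j => ?_)
      refine Set.Subsingleton.finite fun c hcm d hdm => ?_
      simp only [Set.mem_ofPred_eq, map_add, Derivation.map_smul] at hcm hdm
      have hsub : (c - d) • MvPolynomial.pderiv j Q = 0 := by
        rw [sub_smul, sub_eq_zero]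
        exact add_left_cancel (hcm.trans hdm.symm)
      rcases smul_eq_zero.1 hsub with h0 | h0
      · exact sub_eq_zero.1 h0
      · rw [h0, smul_zero, add_zero] at hcm
        exact absurd hcm (hc i j)
    obtain ⟨c, hcm⟩ := hfin.infinite_compl.nonempty
    simp only [Set.mem_compl_iff, Set.mem_union, Set.mem_singleton_iff, Set.mem_iUnion,
      Set.mem_ofPred_eq, not_or, not_exists] at hcm
    exact ⟨c, hcm⟩
  have hne := h (Function.update Φ i (Φ i + c • Q)) ?_ ?_
  · have := congrFun hne i
    rw [Function.update_self, left_eq_add, smul_eq_zero] at this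
    exact this.elim hc0 hQ0
  · intro l j
    rcases eq_or_ne l i with rfl | hl
    · rw [Function.update_self]
      exact hcj j
    · rw [Function.update_of_ne hl]
      exact hc l j
  · rw [measuredFunctions_eq_iff hN]
    refine eq_staticOutput fun l => ?_
    rw [staticOutput_eq]
    rcases eq_or_ne l i with rfl | hl
    · rw [Function.update_self, map_add, map_smul, hQ, smul_zero, add_zero]
    · rw [Function.update_of_ne hl]

/-! ### Algebraically independent outputs are linked to the excitations -/

/-- The number of strict ancestors of a node. -/
noncomputable def depth (N : DAGNetwork V) (i : V) : ℕ :=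
  {u | Relation.TransGen N.graph.Adj u i}.ncard

theorem depth_lt [Finite V] {j i : V} (h : N.graph.Adj j i) : N.depth j < N.depth i := by
  refine Set.ncard_lt_ncard ⟨fun u hu => hu.tail h, fun hsub => ?_⟩ (Set.toFinite _)
  exact N.acyclic j (hsub (Relation.TransGen.single h))

theorem depth_le_getLast [Finite V] {p : List V} (hp : p.IsChain N.graph.Adj) {b : V}
    (hb : p.getLast? = some b) {v : V} (hv : v ∈ p) : v = b ∨ N.depth v < N.depth b := by
  induction p generalizing v with
  | nil => simp at hv
  | cons x l ih =>
    cases l with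
    | nil =>
      simp at hb hv
      exact Or.inl (hv.trans hb)
    | cons y l =>
      rw [List.isChain_cons_cons] at hp
      have ih' := @ih hp.2 (by simpa using hb)
      rcases List.mem_cons.1 hv with rfl | hv
      · right
        rcases ih' List.mem_cons_self with h | h
        · exact h ▸ depth_lt hp.1
        · exact (depth_lt hp.1).trans h
      · exact ih' hv

/-- A system of mutually vertex-disjoint paths from the excited nodes to the nodes in `X`. -/
def IsLinkage (N : DAGNetwork V) (X : Finset V) (p : V → List V) : Prop :=
  (∀ x ∈ X, ∃ a ∈ N.excited, N.IsPath (p x) a x) ∧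
    ∀ x ∈ X, ∀ y ∈ X, x ≠ y → List.Disjoint (p x) (p y)

-- Depth increases strictly along edges, so a node `x` of maximal depth lies on no path ending at
-- another node of `X`. Hence the new path need only avoid the others away from `x`.
open Classical in
theorem IsLinkage.update [Finite V] {X : Finset V} {p : V → List V} {x : V} {q : List V}
    (hp : N.IsLinkage (X.erase x) p) (hmax : ∀ y ∈ X, N.depth y ≤ N.depth x)
    (hq : ∃ a ∈ N.excited, N.IsPath q a x)
    (hdisj : ∀ y ∈ X.erase x, ∀ v ∈ q, v ∈ p y → v = x) :
    N.IsLinkage X (Function.update p x q) := by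
  have key : ∀ y ∈ X, y ≠ x → List.Disjoint q (p y) := by
    intro y hy hyx v hvq hvy
    have hy' := Finset.mem_erase.2 ⟨hyx, hy⟩
    obtain rfl := hdisj y hy' v hvq hvy
    obtain ⟨a, -, hpath⟩ := hp.1 y hy'
    rcases depth_le_getLast hpath.1 hpath.2.2 hvy with h | h
    · exact hyx h.symm
    · exact absurd (hmax y hy) (not_le.2 h)
  refine ⟨fun y hy => ?_, fun y hy z hz hyz => ?_⟩
  · rcases eq_or_ne y x with rfl | hyx
    · rwa [Function.update_self]
    · rw [Function.update_of_ne hyx]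
      exact hp.1 y (Finset.mem_erase.2 ⟨hyx, hy⟩)
  · rcases eq_or_ne y x with rfl | hyx
    · rw [Function.update_self, Function.update_of_ne hyz.symm]
      exact key z hz hyz.symm
    · rw [Function.update_of_ne hyx]
      rcases eq_or_ne z x with rfl | hzx
      · rw [Function.update_self]
        exact (key y hy hyx).symm
      · rw [Function.update_of_ne hzx]
        exact hp.2 y (Finset.mem_erase.2 ⟨hyx, hy⟩) z (Finset.mem_erase.2 ⟨hzx, hz⟩) hyz

/-- The elements algebraic over a subalgebra form a subalgebra, and the output of a non-excited node
is a polynomial in those of its in-neighbours. -/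
theorem exists_inNbr_transcendental [Finite V] (Φ : N.NodeFunctions) {x : V}
    (hx : x ∉ N.excited) (S : Set (MvPolynomial N.excited ℝ))
    (h : Transcendental (Algebra.adjoin ℝ S) (N.staticOutput Φ x)) :
    ∃ z, N.graph.Adj z x ∧ Transcendental (Algebra.adjoin ℝ S) (N.staticOutput Φ z) := by
  by_contra! hcon
  apply h
  have hmem : N.staticOutput Φ x ∈ (Subalgebra.algebraicClosure (Algebra.adjoin ℝ S)
      (MvPolynomial N.excited ℝ)).restrictScalars ℝ := by
    have hz : ∀ j : N.InNbr x, N.staticOutput Φ j.1 ∈ (Subalgebra.algebraicClosure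
        (Algebra.adjoin ℝ S) (MvPolynomial N.excited ℝ)).restrictScalars ℝ :=
      fun j => not_not.1 (hcon j.1 j.2)
    rw [staticOutput_eq, source, dif_neg hx, zero_add]
    have := Subalgebra.mvPolynomial_aeval_coe _
      (fun j : N.InNbr x => (⟨N.staticOutput Φ j.1, hz j⟩ : Subalgebra.restrictScalars ℝ _)) (Φ x)
    rw [this]
    exact SetLike.coe_mem _
  exact hmem

theorem exists_isLinkage [Finite V] (Φ : N.NodeFunctions) (X : Finset V)
    (hX : AlgebraicIndepOn ℝ (N.staticOutput Φ) (X : Set V)) : ∃ p, N.IsLinkage X p := by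
  classical
  -- The summand 1 makes the sum drop even when an excited node of depth 0 is removed.
  induction hn : ∑ x ∈ X, (N.depth x + 1) using Nat.strong_induction_on generalizing X with
  | _ n ih =>
  rcases X.eq_empty_or_nonempty with rfl | hne
  · exact ⟨fun _ => [], by simp [IsLinkage]⟩
  obtain ⟨x, hxX, hmax⟩ := X.exists_max_image N.depth hne
  have hsum := Finset.add_sum_erase X (fun x => N.depth x + 1) hxX
  have hXe : (X : Set V) = insert x ((X.erase x : Finset V) : Set V) := by
    rw [← Finset.coe_insert, Finset.insert_erase hxX]
  rw [hXe, AlgebraicIndepOn.insert_iff (by simp)] at hX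
  by_cases hx : x ∈ N.excited
  · obtain ⟨p, hp⟩ := ih _ (by omega) (X.erase x) hX.1 rfl
    refine ⟨_, hp.update hmax ⟨x, hx, isPath_singleton x⟩ ?_⟩
    intro y _ v hv _
    simpa using hv
  · obtain ⟨z, hzx, hz⟩ := exists_inNbr_transcendental Φ hx _ hX.2
    have hzX : z ∉ X.erase x := fun hmem => hz <| isAlgebraic_algebraMap
      (⟨_, Algebra.subset_adjoin ⟨z, hmem, rfl⟩⟩ :
        Algebra.adjoin ℝ (N.staticOutput Φ '' ((X.erase x : Finset V) : Set V)))
    have hins := hX.1.insert hz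
    rw [← Finset.coe_insert] at hins
    have hlt := depth_lt hzx
    obtain ⟨p, hp⟩ := ih _ (by rw [Finset.sum_insert hzX]; omega) (insert z (X.erase x)) hins rfl
    have hp' : N.IsLinkage (X.erase x) p :=
      ⟨fun y hy => hp.1 y (Finset.mem_insert_of_mem hy), fun y hy y' hy' =>
        hp.2 y (Finset.mem_insert_of_mem hy) y' (Finset.mem_insert_of_mem hy')⟩
    obtain ⟨a, ha, hpath⟩ := hp.1 z (Finset.mem_insert_self _ _)
    refine ⟨_, hp'.update hmax ⟨a, ha, hpath.concat hzx⟩ ?_⟩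
    intro y hy v hv hvy
    rcases List.mem_append.1 hv with hv | hv
    · have hne : z ≠ y := by
        rintro rfl
        exact hzX hy
      exact absurd hvy (hp.2 z (Finset.mem_insert_self _ _) y (Finset.mem_insert_of_mem hy) hne hv)
    · simpa using hv

theorem IndependentInputs.hasVertexDisjointPaths [Finite V] {Φ : N.NodeFunctions}
    (h : IndependentInputs Φ) : N.HasVertexDisjointPaths := by
  intro i
  obtain ⟨p, hp⟩ := exists_isLinkage Φ (Set.toFinite {j | N.graph.Adj j i}).toFinset
    (by rw [Set.Finite.coe_toFinset]; exact h i)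
  refine ⟨fun j => p j.1, fun j => hp.1 j.1 (by simp), fun j j' hjj' =>
    hp.2 j.1 (by simp) j'.1 (by simp) (Subtype.coe_ne_coe.2 hjj')⟩

end DAGNetwork

/-! ### Polynomial dependence on the coefficients -/

/-- The algebra of the polynomial functions on `ι → ℝ`. -/
noncomputable def mvPolynomialFunctions (ι : Type*) : Subalgebra ℝ ((ι → ℝ) → ℝ) :=
  (MvPolynomial.aeval fun (i : ι) (x : ι → ℝ) => x i).range

theorem coord_mem_mvPolynomialFunctions {ι : Type*} (i : ι) :
    (fun x : ι → ℝ => x i) ∈ mvPolynomialFunctions ι :=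
  ⟨MvPolynomial.X i, MvPolynomial.aeval_X _ _⟩

theorem ae_ne_zero_of_mem_mvPolynomialFunctions {ι : Type*} [Fintype ι] {f : (ι → ℝ) → ℝ}
    (hf : f ∈ mvPolynomialFunctions ι) {x₀ : ι → ℝ} (h₀ : f x₀ ≠ 0) :
    ∀ᵐ x ∂(volume : Measure (ι → ℝ)), f x ≠ 0 := by
  obtain ⟨p, rfl⟩ := hf
  have key : ∀ x : ι → ℝ, MvPolynomial.aeval (fun (i : ι) (x : ι → ℝ) => x i) p x =
      MvPolynomial.eval x p := by
    intro x
    clear h₀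
    induction p using MvPolynomial.induction_on with
    | C r => simp
    | add p q hp hq => rw [map_add, map_add, Pi.add_apply, hp, hq]
    | mul_X p i hp =>
      rw [map_mul, map_mul, Pi.mul_apply, hp, MvPolynomial.aeval_X, MvPolynomial.eval_X]
  have hp : p ≠ 0 := by
    rintro rfl
    simp at h₀
  filter_upwards [MvPolynomial.ae_eval_ne_zero hp] with x hx
  exact (key x).trans_ne hx

theorem eval_mem_of_mem {A σ : Type*} {S : Subalgebra ℝ (A → ℝ)} {y : A → σ → ℝ}
    (hy : ∀ j, (fun α => y α j) ∈ S) (Q : MvPolynomial σ ℝ) :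
    (fun α => MvPolynomial.eval (y α) Q) ∈ S := by
  induction Q using MvPolynomial.induction_on with
  | C r =>
    simp only [MvPolynomial.eval_C]
    exact S.algebraMap_mem r
  | add p q hp hq =>
    simp only [map_add]
    exact S.add_mem hp hq
  | mul_X p i hp =>
    simp only [map_mul, MvPolynomial.eval_X]
    exact S.mul_mem hp (hy i)

theorem sum_mem_of_mem {A κ : Type*} {S : Subalgebra ℝ (A → ℝ)} (s : Finset κ) {f : κ → A → ℝ}
    (hf : ∀ k ∈ s, (fun α => f k α) ∈ S) : (fun α => ∑ k ∈ s, f k α) ∈ S := by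
  simpa only [← Finset.sum_apply] using S.sum_mem hf

theorem det_mem_of_mem {A n : Type*} [Fintype n] [DecidableEq n] {S : Subalgebra ℝ (A → ℝ)}
    {M : A → Matrix n n ℝ} (hM : ∀ j l, (fun α => M α j l) ∈ S) :
    (fun α => (M α).det) ∈ S := by
  simp only [Matrix.det_apply']
  refine sum_mem_of_mem _ fun s _ => S.mul_mem (S.intCast_mem _) ?_
  have := S.prod_mem (t := Finset.univ) (f := fun (l : n) (α : A) => M α (s l) l)
    fun l _ => hM (s l) l
  simpa only [Finset.prod_fn] using this

/-! ### The Jacobian of the static outputs at zero excitation -/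

namespace DAGNetwork

variable {V : Type*} {N : DAGNetwork V}

open Classical in
theorem pderiv_source (i : V) (a : N.excited) :
    MvPolynomial.pderiv a (N.source i) = if i = a.1 then 1 else 0 := by
  unfold source
  split_ifs with h1 h2 h2
  · subst h2
    exact MvPolynomial.pderiv_X_self _
  · exact MvPolynomial.pderiv_X_of_ne fun h => h2 (congrArg Subtype.val h)
  · exact absurd (h2 ▸ a.2) h1
  · exact map_zero _

theorem eval_zero_source (i : V) : MvPolynomial.eval 0 (N.source i) = 0 := by
  unfold source
  split_ifs <;> simp

/-- The derivative of the static output of the node `i` with respect to the excitation of `a`, at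
zero excitation. -/
noncomputable def jacobian [Finite V] (Φ : N.NodeFunctions) (i : V) (a : N.excited) : ℝ :=
  MvPolynomial.eval 0 (MvPolynomial.pderiv a (N.staticOutput Φ i))

theorem eval_zero_staticOutput [Finite V] (Φ : N.NodeFunctions) (i : V) :
    MvPolynomial.eval 0 (N.staticOutput Φ i) =
      MvPolynomial.eval (fun j : N.InNbr i => MvPolynomial.eval 0 (N.staticOutput Φ j.1)) (Φ i) := by
  rw [staticOutput_eq, map_add, eval_zero_source, zero_add, MvPolynomial.eval_aeval]

open Classical in
theorem jacobian_eq [Fintype V] (Φ : N.NodeFunctions) (i : V) (a : N.excited) :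
    N.jacobian Φ i a = (if i = a.1 then 1 else 0) + ∑ j : N.InNbr i,
      MvPolynomial.eval (fun j : N.InNbr i => MvPolynomial.eval 0 (N.staticOutput Φ j.1))
        (MvPolynomial.pderiv j (Φ i)) * N.jacobian Φ j.1 a := by
  unfold jacobian
  rw [staticOutput_eq, map_add, map_add, pderiv_source, MvPolynomial.pderiv_aeval, map_sum]
  congr 1
  · split_ifs <;> simp
  · simp only [map_mul, MvPolynomial.eval_aeval]

theorem coeff_parametrize [Finite V] {K : ℕ} (α : N.Param K) {β : N.NodeFunctions}
    (hβ : N.IsTail K β) (i : V) (d : N.LowExponent K i) :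
    MvPolynomial.coeff d.1 (N.parametrize K α β i) = α ⟨i, d⟩ := by
  classical
  rw [parametrize, MvPolynomial.coeff_add, hβ i d.1 d.2, add_zero, MvPolynomial.coeff_sum,
    Finset.sum_eq_single d]
  · simp
  · intro e _ he
    rw [MvPolynomial.coeff_monomial, if_neg fun h => he (Subtype.ext h)]
  · simp

/-- The family is affine in `α`. The linear map `D` covers both the node function itself and its
partial derivatives. -/
theorem eval_map_parametrize_mem [Finite V] {K : ℕ} {σ : Type*} (β : N.NodeFunctions) (i : V)
    (D : MvPolynomial (N.InNbr i) ℝ →ₗ[ℝ] MvPolynomial σ ℝ)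
    {S : Subalgebra ℝ (N.Param K → ℝ)} (hS : ∀ t, (fun α => α t) ∈ S) {y : N.Param K → σ → ℝ}
    (hy : ∀ j, (fun α => y α j) ∈ S) :
    (fun α => MvPolynomial.eval (y α) (D (N.parametrize K α β i))) ∈ S := by
  have heq : ∀ α : N.Param K, MvPolynomial.eval (y α) (D (N.parametrize K α β i)) =
      ∑ d : N.LowExponent K i, α ⟨i, d⟩ *
        MvPolynomial.eval (y α) (D (MvPolynomial.monomial d.1 1)) +
      MvPolynomial.eval (y α) (D (β i)) := by
    intro α
    rw [parametrize, map_add, map_add, map_sum, map_sum]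
    congr 1
    refine Finset.sum_congr rfl fun d _ => ?_
    rw [← MvPolynomial.smul_eval, ← map_smul, MvPolynomial.smul_monomial, smul_eq_mul, mul_one]
  simp only [heq]
  exact S.add_mem (sum_mem_of_mem _ fun d _ => S.mul_mem (hS _) (eval_mem_of_mem hy _))
    (eval_mem_of_mem hy _)

theorem eval_zero_staticOutput_mem [Finite V] (K : ℕ) (β : N.NodeFunctions) (i : V) :
    (fun α : N.Param K => MvPolynomial.eval 0 (N.staticOutput (N.parametrize K α β) i)) ∈
      mvPolynomialFunctions _ := by
  induction i using N.wellFounded_adj.induction with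
  | _ i ih =>
  simp only [eval_zero_staticOutput _ i]
  exact eval_map_parametrize_mem β i LinearMap.id coord_mem_mvPolynomialFunctions
    fun j => ih j.1 j.2

theorem jacobian_mem [Fintype V] (K : ℕ) (β : N.NodeFunctions) (i : V) (a : N.excited) :
    (fun α : N.Param K => N.jacobian (N.parametrize K α β) i a) ∈ mvPolynomialFunctions _ := by
  classical
  induction i using N.wellFounded_adj.induction with
  | _ i ih =>
  simp only [jacobian_eq _ i]
  refine Subalgebra.add_mem _ ?_ (sum_mem_of_mem _ fun j _ => Subalgebra.mul_mem _ ?_ (ih j.1 j.2))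
  · exact Subalgebra.algebraMap_mem _ (if i = a.1 then (1 : ℝ) else 0)
  · exact eval_map_parametrize_mem β i (MvPolynomial.pderiv j).toLinearMap
      coord_mem_mvPolynomialFunctions fun j => eval_zero_staticOutput_mem K β j.1

/-! ### A linear network that routes the excitations along disjoint paths -/

open Classical in
/-- The linear coefficient of an edge is one if both ends lie on the same path of the family `p`;
all other coefficients vanish. -/
noncomputable def routing (N : DAGNetwork V) {ι : Type*} (p : ι → List V) : N.Param 1 :=
  fun t => if ∃ w : N.InNbr t.1, t.2.1 = Finsupp.single w 1 ∧ ∃ j, w.1 ∈ p j ∧ t.1 ∈ p j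
    then 1 else 0

variable {ι : Type*} {p : ι → List V} {β : N.NodeFunctions}

/-- The constant terms vanish, so zero is the response to zero excitation. The Jacobian then sees
only the linear coefficients and never the tail `β`. -/
theorem eval_zero_staticOutput_routing [Finite V] (hβ : N.IsTail 1 β) (i : V) :
    MvPolynomial.eval 0 (N.staticOutput (N.parametrize 1 (N.routing p) β) i) = 0 := by
  induction i using N.wellFounded_adj.induction with
  | _ i ih =>
  rw [eval_zero_staticOutput, funext fun j : N.InNbr i => ih j.1 j.2]
  change MvPolynomial.eval 0 _ = 0
  rw [MvPolynomial.eval_zero, MvPolynomial.constantCoeff_eq]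
  have := coeff_parametrize (N.routing p) hβ i ⟨0, by simp⟩
  rw [this, routing, if_neg]
  rintro ⟨w, hw, -⟩
  simp [eq_comm] at hw

open Classical in
theorem jacobian_routing_eq [Fintype V] (hβ : N.IsTail 1 β) (i : V) (a : N.excited) :
    N.jacobian (N.parametrize 1 (N.routing p) β) i a = (if i = a.1 then 1 else 0) +
      ∑ w : N.InNbr i, (if ∃ j, w.1 ∈ p j ∧ i ∈ p j then 1 else 0) *
        N.jacobian (N.parametrize 1 (N.routing p) β) w.1 a := by
  rw [jacobian_eq]
  congr 1
  refine Finset.sum_congr rfl fun w _ => ?_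
  congr 1
  rw [funext fun j : N.InNbr i => eval_zero_staticOutput_routing hβ j.1]
  refine (MvPolynomial.eval_zero_pderiv _ w).trans ?_
  have := coeff_parametrize (N.routing p) hβ i ⟨Finsupp.single w 1, by simp⟩
  rw [this, routing]
  by_cases h : ∃ j, w.1 ∈ p j ∧ i ∈ p j
  · rw [if_pos h]
    exact if_pos ⟨w, rfl, h⟩
  · rw [if_neg h]
    refine if_neg ?_
    rintro ⟨w', hw', h'⟩
    rw [← Finsupp.single_left_injective one_ne_zero hw'] at h'
    exact h h'

theorem jacobian_routing_nonneg [Fintype V] (hβ : N.IsTail 1 β) (i : V) (a : N.excited) :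
    0 ≤ N.jacobian (N.parametrize 1 (N.routing p) β) i a := by
  classical
  induction i using N.wellFounded_adj.induction with
  | _ i ih =>
  rw [jacobian_routing_eq hβ]
  refine add_nonneg (by split_ifs <;> simp) (Finset.sum_nonneg fun w _ => mul_nonneg ?_ (ih _ w.2))
  split_ifs <;> simp

/-- A nonzero derivative at a node of `p j` comes from the node's own excitation or through an edge
with both ends on one path, which by disjointness is `p j`. Tracing back, the influence never leaves
`p j`. -/
theorem mem_of_jacobian_routing_ne_zero [Fintype V] (hβ : N.IsTail 1 β)
    (hp : ∀ j j', j ≠ j' → List.Disjoint (p j) (p j')) {i : V} {a : N.excited} {j : ι}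
    (hi : i ∈ p j) (h : N.jacobian (N.parametrize 1 (N.routing p) β) i a ≠ 0) : a.1 ∈ p j := by
  classical
  induction i using N.wellFounded_adj.induction with
  | _ i ih =>
  rw [jacobian_routing_eq hβ] at h
  by_cases hia : i = a.1
  · exact hia ▸ hi
  rw [if_neg hia, zero_add] at h
  obtain ⟨w, -, hw⟩ := Finset.exists_ne_zero_of_sum_ne_zero h
  have hw1 := left_ne_zero_of_mul hw
  rw [ite_ne_right_iff] at hw1
  obtain ⟨⟨j', hwj', hij'⟩, -⟩ := hw1
  have hj : j' = j := by
    by_contra hne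
    exact hp j' j hne hij' hi
  exact ih w.1 w.2 (hj ▸ hwj') (right_ne_zero_of_mul hw)

theorem one_le_jacobian_routing_self [Fintype V] (hβ : N.IsTail 1 β) (a : N.excited) :
    1 ≤ N.jacobian (N.parametrize 1 (N.routing p) β) a.1 a := by
  classical
  rw [jacobian_routing_eq hβ, if_pos rfl]
  refine le_add_of_nonneg_right (Finset.sum_nonneg fun w _ => mul_nonneg ?_
    (jacobian_routing_nonneg hβ _ _))
  split_ifs <;> simp

theorem jacobian_routing_le_of_adj [Fintype V] (hβ : N.IsTail 1 β) {w i : V}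
    (hwi : N.graph.Adj w i) {j : ι} (hw : w ∈ p j) (hi : i ∈ p j) (a : N.excited) :
    N.jacobian (N.parametrize 1 (N.routing p) β) w a ≤
      N.jacobian (N.parametrize 1 (N.routing p) β) i a := by
  classical
  rw [jacobian_routing_eq hβ i]
  have h := Finset.single_le_sum (f := fun w : N.InNbr i =>
      (if ∃ j, w.1 ∈ p j ∧ i ∈ p j then (1 : ℝ) else 0) *
        N.jacobian (N.parametrize 1 (N.routing p) β) w.1 a)
    (fun w _ => mul_nonneg (by split_ifs <;> simp) (jacobian_routing_nonneg hβ _ _))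
    (Finset.mem_univ ⟨w, hwi⟩)
  simp only at h
  rw [if_pos ⟨j, hw, hi⟩, one_mul] at h
  exact h.trans (le_add_of_nonneg_left (by split_ifs <;> simp))

/-- Edges joining non-consecutive nodes of a path also have coefficient one, so the gain along a
path need not equal 1; nonnegativity rules out cancellation and leaves a lower bound. -/
theorem jacobian_routing_le_of_isChain [Fintype V] (hβ : N.IsTail 1 β) {j : ι} (a : N.excited)
    {l : List V} {x b : V} (hl : (x :: l).IsChain N.graph.Adj) (hsub : x :: l ⊆ p j)
    (hb : (x :: l).getLast? = some b) :
    N.jacobian (N.parametrize 1 (N.routing p) β) x a ≤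
      N.jacobian (N.parametrize 1 (N.routing p) β) b a := by
  induction l generalizing x with
  | nil =>
    simp at hb
    rw [hb]
  | cons y l ih =>
    rw [List.isChain_cons_cons] at hl
    rw [List.cons_subset] at hsub
    exact (jacobian_routing_le_of_adj hβ hl.1 hsub.1 (hsub.2 List.mem_cons_self) a).trans
      (ih hl.2 hsub.2 (by simpa using hb))

theorem det_jacobian_routing_ne_zero [Fintype V] [Fintype ι] [DecidableEq ι]
    (hβ : N.IsTail 1 β) {a : ι → N.excited} {b : ι → V}
    (hpath : ∀ j, N.IsPath (p j) (a j).1 (b j))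
    (hp : ∀ j j', j ≠ j' → List.Disjoint (p j) (p j')) :
    (Matrix.of fun j l => N.jacobian (N.parametrize 1 (N.routing p) β) (b j) (a l)).det ≠ 0 := by
  have ha : ∀ j, (a j).1 ∈ p j := fun j => List.mem_of_mem_head? (hpath j).2.1
  have hb : ∀ j, b j ∈ p j := fun j => List.mem_of_getLast? (hpath j).2.2
  -- Row `j` is influenced only by excitations on `p j`, and the start of `p l` is not there for `l
  -- ≠ j`.
  have hdiag : (Matrix.of fun j l =>
      N.jacobian (N.parametrize 1 (N.routing p) β) (b j) (a l)) =
      Matrix.diagonal fun j => N.jacobian (N.parametrize 1 (N.routing p) β) (b j) (a j) := by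
    ext j l
    rcases eq_or_ne j l with rfl | hjl
    · simp
    · rw [Matrix.diagonal_apply_ne _ hjl, Matrix.of_apply]
      by_contra hne
      exact hp j l hjl (mem_of_jacobian_routing_ne_zero hβ hp (hb j) hne) (ha l)
  rw [hdiag, Matrix.det_diagonal]
  refine Finset.prod_ne_zero_iff.2 fun j _ => (zero_lt_one.trans_le ?_).ne'
  obtain ⟨h1, h2, h3⟩ := hpath j
  refine (one_le_jacobian_routing_self (p := p) hβ (a j)).trans ?_
  obtain ⟨l, hl⟩ := List.head?_eq_some_iff.1 h2
  rw [hl] at h1 h3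
  exact jacobian_routing_le_of_isChain hβ (a j) h1 (by rw [hl]; exact List.Subset.refl _) h3

/-! ### Generic identifiability -/

theorem HasVertexDisjointPaths.kGenerically_independentInputs [Fintype V]
    (h : N.HasVertexDisjointPaths) : N.KGenerically 1 fun Φ => IndependentInputs Φ := by
  classical
  intro β hβ
  unfold IndependentInputs
  rw [ae_all_iff]
  intro i
  obtain ⟨p, hp, hdisj⟩ := h i
  choose a ha hpath using hp
  have hmem := det_mem_of_mem fun j l : N.InNbr i => jacobian_mem 1 β j.1 ⟨a l, ha l⟩
  filter_upwards [ae_ne_zero_of_mem_mvPolynomialFunctions hmem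
    (det_jacobian_routing_ne_zero hβ (a := fun l => ⟨a l, ha l⟩) hpath hdisj)] with α hα
  exact MvPolynomial.algebraicIndependent_of_det_ne_zero _ (fun l => ⟨a l, ha l⟩) hα

/-- A nonzero linear coefficient makes the partial derivative nonzero at the origin; `0 < K` makes
that coefficient one of the free parameters. -/
theorem ae_consistent_parametrize [Fintype V] {K : ℕ} (hK : 0 < K) {β : N.NodeFunctions}
    (hβ : N.IsTail K β) :
    ∀ᵐ α ∂(volume : Measure (N.Param K)), N.Consistent (N.parametrize K α β) := by
  unfold Consistent
  simp only [ae_all_iff]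
  intro i j
  have hd : (Finsupp.single j 1 : N.InNbr i →₀ ℕ).degree ≤ K := by
    rw [Finsupp.degree_single]
    exact hK
  filter_upwards [ae_ne_zero_of_mem_mvPolynomialFunctions
    (coord_mem_mvPolynomialFunctions (⟨i, ⟨_, hd⟩⟩ : Σ i, N.LowExponent K i))
    (x₀ := fun _ => 1) one_ne_zero] with α hα h0
  apply hα
  have := coeff_parametrize α hβ i ⟨_, hd⟩
  rw [← this, ← MvPolynomial.eval_zero_pderiv, h0, map_zero]

theorem GenericallyIdentifiable.truncated [Fintype V] (h : N.GenericallyIdentifiable) :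
    N.TruncatedGenericallyIdentifiable := by
  obtain ⟨K, hK, h⟩ := h
  exact ⟨K, hK, h 0 fun _ _ _ => MvPolynomial.coeff_zero _⟩

theorem TruncatedGenericallyIdentifiable.hasVertexDisjointPaths [Fintype V]
    (hN : N.PathIndependentDelay) (h : N.TruncatedGenericallyIdentifiable) :
    N.HasVertexDisjointPaths := by
  obtain ⟨K, hK, h⟩ := h
  -- One consistent identifiable family suffices, and two almost sure properties hold together at
  -- some point.
  obtain ⟨α, hα, hc⟩ := (h.and (ae_consistent_parametrize hK
    fun _ _ _ => MvPolynomial.coeff_zero _)).exists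
  exact (hα.independentInputs hN hc).hasVertexDisjointPaths

theorem HasVertexDisjointPaths.genericallyIdentifiable [Fintype V]
    (hN : N.PathIndependentDelay) (h : N.HasVertexDisjointPaths) : N.GenericallyIdentifiable := by
  refine ⟨1, one_pos, fun β hβ => ?_⟩
  filter_upwards [h.kGenerically_independentInputs β hβ] with α hα
  exact hα.identifiable hN

end DAGNetwork

theorem theorem2 {V : Type*} [Fintype V] (N : DAGNetwork V) (hN : N.PathIndependentDelay) :
    (N.GenericallyIdentifiable ↔ N.HasVertexDisjointPaths) ∧
      (N.TruncatedGenericallyIdentifiable ↔ N.HasVertexDisjointPaths) :=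
  ⟨⟨fun h => h.truncated.hasVertexDisjointPaths hN, fun h => h.genericallyIdentifiable hN⟩,
    fun h => h.hasVertexDisjointPaths hN, fun h => (h.genericallyIdentifiable hN).truncated⟩
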